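/- Let $G$ be a finite simple unicyclic graph, i.e. a connected graph with exactly one cycle. Let $C$ be its cycle, with vertices $v_1,\dots,v_r$, and let $\Delta\ge 3$ be its maximum degree. Deleting the edges of $C$ from $G$ leaves a forest of $r$ trees $T_1,\dots,T_r$ rooted at $v_1,\dots,v_r$. Let $h(T_i)$ be the height of $T_i$, i.e. the largest distance from $v_i$ to a pendant vertex (a vertex of degree one) of $T_i$ (with $h(T_i)=0$ if $T_i$ is a single vertex), and let $k(G)=1+\max_{1\le i\le r} h(T_i)$ be the height of $G$. For $\alpha\in[0,1)$ let $A_\alpha(G)=\alpha D(G)+(1-\alpha)A(G)$, where $D(G)$ is the diagonal matrix of vertex degrees and $A(G)$ is the adjacency matrix of $G$, and let $\rho$ denote the spectral radius (the largest modulus of an eigenvalue). If $\Delta\ge 4$, or if $\Delta=3$ and $k(G)\ge 4$, then for every $\alpha\in[0,1)$ $$\rho(A_\alpha(G)) < \alpha\Delta+2(1-\alpha)\sqrt{\Delta-1}\,\cos\frac{\pi}{2k(G)+1}.$$ -/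

import Mathlib

namespace SimpleGraph

variable {V : Type*}

/-- `C` is a cycle of `G`: the subgraph formed by the vertices and edges of some closed walk
without repetitions. -/
def IsCycleSubgraph (G : SimpleGraph V) (C : G.Subgraph) : Prop :=
  ∃ (v : V) (p : G.Walk v v), p.IsCycle ∧ p.toSubgraph = C

/-- A unicyclic graph: a connected graph with exactly one cycle. -/
def IsUnicyclic (G : SimpleGraph V) : Prop :=
  G.Connected ∧ ∃! C : G.Subgraph, G.IsCycleSubgraph C

/-- The unique cycle of a unicyclic graph. -/
noncomputable def IsUnicyclic.cycle {G : SimpleGraph V} (hG : G.IsUnicyclic) : G.Subgraph :=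
  hG.2.choose

theorem IsUnicyclic.isCycleSubgraph_cycle {G : SimpleGraph V} (hG : G.IsUnicyclic) :
    G.IsCycleSubgraph hG.cycle :=
  hG.2.choose_spec.1

/-- A pendant vertex: a vertex of degree one. -/
def IsPendant (F : SimpleGraph V) (w : V) : Prop :=
  ∃! u : V, F.Adj w u

open Classical in
/-- The height of the rooted tree that is the connected component of `v` in the forest `F`, with
root `v`: the largest distance from `v` to a pendant vertex of the component.
It is `0` if the component consists of `v` alone. -/
noncomputable def rootedHeight [Fintype V] (F : SimpleGraph V) (v : V) : ℕ :=
  (Finset.univ.filter fun w : V => F.Reachable v w ∧ F.IsPendant w).sup fun w => F.dist v w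

open Classical in
/-- The height `k(G)` of a unicyclic graph with cycle `C`: one more than the largest height of the
trees of the forest `G - E(C)`, each rooted at its vertex on `C`. -/
noncomputable def IsUnicyclic.height [Fintype V] {G : SimpleGraph V} (hG : G.IsUnicyclic) : ℕ :=
  ((Finset.univ.filter fun v : V => v ∈ hG.cycle.verts).sup fun v =>
    (G.deleteEdges hG.cycle.edgeSet).rootedHeight v) + 1

/-- The matrix `A_α(G) = α D(G) + (1 - α) A(G)`, where `D(G)` is the diagonal matrix of the vertex
degrees and `A(G)` the adjacency matrix. -/
def alphaMatrix [Fintype V] [DecidableEq V] (G : SimpleGraph V) [DecidableRel G.Adj] (α : ℝ) :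
    Matrix V V ℝ :=
  α • G.degMatrix ℝ + (1 - α) • G.adjMatrix ℝ

end SimpleGraph

/-! Since degrees are at most Δ, it suffices to find a positive x with A(G) x ≤ 2 s cos θ · x,
strict somewhere, where s = √(Δ - 1) and θ = π/(2k + 1); connectedness then makes the eigenvalue
bound strict. Take x constant on levels (distance to the cycle), with value w_j = sin((k - j)θ)/s^j.
Off the cycle a vertex has one parent and at most s² children, so `levelWeight_recurrence` gives the
bound; w_k = 0 matches the absence of level k. On the cycle there are two neighbours of level 0 and
at most s² - 1 of level 1. As sin((k + 1)θ) = sin(kθ), w_1 is a multiple of w_0, and the bound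
reduces to 2s - s² < 2 cos θ - 1, which is where the condition on Δ and k enters. -/

/-- Collatz–Wielandt bound, strict form: if a matrix is nonnegative, positive along the edges of a
connected graph, and `A x ≤ M x` for a positive vector `x` with strict inequality somewhere, then
the spectral radius of `A` is less than `M`. -/
theorem Matrix.spectralRadius_lt_of_mulVec_le {V : Type*} [Fintype V] [DecidableEq V]
    {G : SimpleGraph V} (hG : G.Connected) {A : Matrix V V ℝ} (hA : ∀ i j, 0 ≤ A i j)
    (hadj : ∀ i j, G.Adj i j → 0 < A i j) {x : V → ℝ} (hx : ∀ i, 0 < x i) {M : ℝ}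
    (hle : ∀ i, ∑ j, A i j * x j ≤ M * x i) {i₀ : V} (hlt : ∑ j, A i₀ j * x j < M * x i₀) :
    spectralRadius ℝ A < ENNReal.ofReal M := by
  have hM : 0 < M := by
    have h0 : 0 ≤ ∑ j, A i₀ j * x j :=
      Finset.sum_nonneg fun j _ => mul_nonneg (hA _ _) (hx j).le
    exact pos_of_mul_pos_left (h0.trans_lt hlt) (hx i₀).le
  have key : ∀ μ ∈ spectrum ℝ A, |μ| < M := by
    intro μ hμ
    rw [← Matrix.spectrum_toLin', ← Module.End.hasEigenvalue_iff_mem_spectrum] at hμ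
    obtain ⟨f, hf⟩ := hμ.exists_hasEigenvector
    have hf0 : f ≠ 0 := hf.2
    have hmul : ∀ i, ∑ j, A i j * f j = μ * f i := fun i => by
      have := congrFun hf.apply_eq_smul i
      simpa [Matrix.toLin'_apply, Matrix.mulVec, dotProduct] using this
    by_contra! hMμ
    obtain ⟨v, -, hv⟩ := Finset.exists_max_image Finset.univ (fun i => |f i| / x i)
      ⟨i₀, Finset.mem_univ _⟩
    set c := |f v| / x v with hc
    have hfc : ∀ i, |f i| ≤ c * x i := fun i =>
      (div_le_iff₀ (hx i)).1 (hv i (Finset.mem_univ _))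
    have hc0 : 0 < c := by
      obtain ⟨i, hi⟩ := Function.ne_iff.1 hf0
      exact pos_of_mul_pos_left ((abs_pos.2 hi).trans_le (hfc i)) (hx i).le
    -- With `hle`, all inequalities are equalities wherever |f| touches its majorant c x. Contact
    -- thus spreads to neighbours, hence everywhere, contradicting strictness at `i₀`.
    have habs : ∀ i, |f i| = c * x i → M * x i ≤ ∑ j, A i j * (|f j| / c) := by
      intro i hi
      have h1 : M * (c * x i) ≤ ∑ j, A i j * |f j| := by
        calc M * (c * x i) ≤ |μ| * |f i| := by
              rw [hi]; exact mul_le_mul_of_nonneg_right hMμ (mul_nonneg hc0.le (hx i).le)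
          _ = |∑ j, A i j * f j| := by rw [hmul, abs_mul]
          _ ≤ ∑ j, |A i j * f j| := Finset.abs_sum_le_sum_abs _ _
          _ = ∑ j, A i j * |f j| := by simp only [abs_mul, abs_of_nonneg (hA _ _)]
      calc M * x i = M * (c * x i) / c := by field_simp
        _ ≤ (∑ j, A i j * |f j|) / c := by gcongr
        _ = _ := by rw [Finset.sum_div]; simp only [mul_div_assoc]
    have hfx : ∀ j, |f j| / c ≤ x j := fun j => by
      rw [div_le_iff₀ hc0, mul_comm]; exact hfc j
    have hwalk : ∀ {a b} (_ : G.Walk a b), |f b| = c * x b → |f a| = c * x a := by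
      intro a b p hb
      induction p with
      | nil => exact hb
      | @cons a b _ hab p ih =>
        by_contra hne
        have hlt' : |f a| / c < x a := by
          rw [div_lt_iff₀ hc0, mul_comm]; exact lt_of_le_of_ne (hfc a) hne
        have : ∑ j, A b j * (|f j| / c) < ∑ j, A b j * x j :=
          Finset.sum_lt_sum (fun j _ => mul_le_mul_of_nonneg_left (hfx j) (hA _ _))
            ⟨a, Finset.mem_univ _, mul_lt_mul_of_pos_left hlt' (hadj _ _ hab.symm)⟩
        exact absurd ((habs b (ih hb)).trans_lt this) (not_lt.2 (hle b))
    have hall : ∀ i, |f i| = c * x i := fun i =>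
      hwalk (hG.preconnected i v).some (by rw [hc, div_mul_cancel₀ _ (hx _).ne'])
    have h1 : ∑ j, A i₀ j * (|f j| / c) ≤ ∑ j, A i₀ j * x j :=
      Finset.sum_le_sum fun j _ => mul_le_mul_of_nonneg_left (hfx j) (hA _ _)
    exact absurd ((habs i₀ (hall i₀)).trans h1) (not_le.2 hlt)
  have hfin : (spectrum ℝ A).Finite := A.finite_real_spectrum
  rw [spectralRadius]
  have : (⨆ k ∈ spectrum ℝ A, (‖k‖₊ : ENNReal)) =
      hfin.toFinset.sup fun k => (‖k‖₊ : ENNReal) := by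
    rw [Finset.sup_eq_iSup]; simp
  rw [this, Finset.sup_lt_iff (by simpa using hM)]
  intro μ hμ
  rw [← enorm_eq_nnnorm, Real.enorm_eq_ofReal_abs, ENNReal.ofReal_lt_ofReal_iff hM]
  exact key μ (by simpa using hμ)

/-! ### Distances in rooted forests -/

namespace SimpleGraph

variable {V : Type*} {G F : SimpleGraph V}

/-- In a forest, a vertex other than the root has at most one neighbour that is not farther from
the root. -/
theorem IsAcyclic.eq_of_adj_of_dist_le (hF : F.IsAcyclic) {r v u w : V} (hr : F.Reachable r v)
    (hu : F.Adj v u) (hw : F.Adj v w) (hdu : F.dist r u ≤ F.dist r v)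
    (hdw : F.dist r w ≤ F.dist r v) : u = w := by
  classical
  have key : ∀ a, F.Adj v a → F.dist r a ≤ F.dist r v →
      ∃ p : F.Walk r v, p.IsPath ∧ p.penultimate = a := by
    intro a ha hda
    obtain ⟨p, hp, hpl⟩ := (hr.trans ha.reachable).exists_path_of_dist
    -- If v lay on the shortest path to a, it would be strictly closer to r than a.
    refine ⟨p.concat ha.symm, hp.concat ?_ ha.symm, by simp⟩
    intro hv
    have h1 := dist_le (p.takeUntil v hv)
    have h2 := p.length_takeUntil_lt_length hv ha.ne
    omega
  obtain ⟨p, hp, hpu⟩ := key u hu hdu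
  obtain ⟨q, hq, hqw⟩ := key w hw hdw
  have : p = q := congrArg Subtype.val ((hF.subsingleton_path r v).elim ⟨p, hp⟩ ⟨q, hq⟩)
  rw [← hpu, ← hqw, this]

/-- A reachable vertex other than the root has a neighbour closer to the root. -/
theorem Reachable.exists_adj_dist_add_one {r v : V} (hr : F.Reachable r v) (hne : r ≠ v) :
    ∃ u, F.Adj v u ∧ F.dist r u + 1 = F.dist r v := by
  obtain ⟨p, hp, hpl⟩ := hr.exists_path_of_dist
  have hnil : ¬ p.Nil := fun h => hne h.eq
  refine ⟨p.penultimate, (p.adj_penultimate hnil).symm, ?_⟩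
  have h1 := dist_le p.dropLast
  have h2 : p.dropLast.length + 1 = p.length := by
    have := Walk.not_nil_iff_lt_length.1 hnil
    simp; omega
  have h3 := (p.adj_penultimate hnil).diff_dist_adj (u := r)
  omega

/-- The height of a rooted tree bounds the distance of all its vertices from the root. -/
theorem IsAcyclic.dist_le_rootedHeight [Fintype V] (hF : F.IsAcyclic) {r v : V}
    (hr : F.Reachable r v) : F.dist r v ≤ F.rootedHeight r := by
  classical
  -- A farthest vertex other than the root is pendant, as none of its neighbours is farther.
  obtain ⟨w, hw, hmax⟩ := Finset.exists_max_image (Finset.univ.filter (F.Reachable r))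
    (F.dist r) ⟨v, by simpa using hr⟩
  simp only [Finset.mem_filter, Finset.mem_univ, true_and] at hw hmax
  refine (hmax v hr).trans ?_
  by_cases hrw : r = w
  · simp [← hrw]
  obtain ⟨u, hu, -⟩ := hw.exists_adj_dist_add_one hrw
  unfold rootedHeight
  refine Finset.le_sup (f := fun w => F.dist r w) ?_
  simp only [Finset.mem_filter, Finset.mem_univ, true_and]
  exact ⟨hw, u, hu, fun a ha => hF.eq_of_adj_of_dist_le hw ha hu
    (hmax a (hw.trans ha.reachable)) (hmax u (hw.trans hu.reachable))⟩

/-! ### Level structure of a unicyclic graph -/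

namespace IsUnicyclic

theorem toSubgraph_eq_cycle (hG : G.IsUnicyclic) {v : V} {p : G.Walk v v} (hp : p.IsCycle) :
    p.toSubgraph = hG.cycle :=
  hG.2.unique ⟨v, p, hp, rfl⟩ hG.isCycleSubgraph_cycle

/-- A subgraph of a unicyclic graph that misses an edge of the cycle is a forest. -/
theorem isAcyclic_of_le (hG : G.IsUnicyclic) {H : SimpleGraph V} (hle : H ≤ G) {e : Sym2 V}
    (he : e ∈ hG.cycle.edgeSet) (heH : e ∉ H.edgeSet) : H.IsAcyclic := by
  intro v p hp
  rw [← hG.toSubgraph_eq_cycle (hp.mapLe hle), Walk.mem_edges_toSubgraph] at he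
  simp only [Walk.edges_mapLe_eq_edges] at he
  exact heH (p.edges_subset_edgeSet he)

/-- The forest left after deleting the edges of the cycle. -/
abbrev forest (hG : G.IsUnicyclic) : SimpleGraph V := G.deleteEdges hG.cycle.edgeSet

theorem exists_mem_cycle_verts (hG : G.IsUnicyclic) : ∃ c, c ∈ hG.cycle.verts := by
  obtain ⟨v, p, hp, hpC⟩ := hG.isCycleSubgraph_cycle
  exact ⟨v, hpC ▸ p.start_mem_verts_toSubgraph⟩

theorem isAcyclic_forest (hG : G.IsUnicyclic) : hG.forest.IsAcyclic := by
  obtain ⟨v, p, hp, hpC⟩ := hG.isCycleSubgraph_cycle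
  have he : s(v, p.snd) ∈ hG.cycle.edgeSet := by
    rw [← hpC]; exact p.toSubgraph_adj_snd hp.not_nil
  exact hG.isAcyclic_of_le (deleteEdges_le _) he (by simp [edgeSet_deleteEdges, he])

theorem exists_root (hG : G.IsUnicyclic) (v : V) :
    ∃ c ∈ hG.cycle.verts, hG.forest.Reachable c v := by
  obtain ⟨c, hc⟩ := hG.exists_mem_cycle_verts
  induction (hG.1.preconnected v c).some with
  | nil => exact ⟨_, hc, .refl _⟩
  | @cons a b d hab p ih =>
    obtain ⟨r, hr, hrb⟩ := ih hc
    by_cases h : s(a, b) ∈ hG.cycle.edgeSet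
    · exact ⟨a, hG.cycle.edge_vert h, .refl _⟩
    · exact ⟨r, hr, hrb.trans (Adj.reachable (by simp [hab.symm, Sym2.eq_swap, h]))⟩

/-- Otherwise a forest path and an arc of the cycle would join c' to c in the acyclic graph G - e,
with e a cycle edge at c. They would coincide, putting a cycle edge in the forest. -/
theorem eq_of_reachable_forest (hG : G.IsUnicyclic) {c c' : V} (hc : c ∈ hG.cycle.verts)
    (hc' : c' ∈ hG.cycle.verts) (h : hG.forest.Reachable c' c) : c' = c := by
  classical
  obtain ⟨v, p, hp, hpC⟩ := hG.isCycleSubgraph_cycle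
  have hcp : c ∈ p.support := by rwa [← hpC, Walk.mem_verts_toSubgraph] at hc
  obtain ⟨q, hq, hqC⟩ : ∃ q : G.Walk c c, q.IsCycle ∧ q.toSubgraph = hG.cycle :=
    ⟨p.rotate c hcp, hp.rotate hcp, hG.toSubgraph_eq_cycle (hp.rotate hcp)⟩
  by_contra hne
  cases q with
  | nil => exact hq.not_nil .nil
  | @cons _ w _ hcw t =>
    rw [Walk.cons_isCycle_iff] at hq
    have hc't : c' ∈ t.support := by
      rw [← hqC, Walk.mem_verts_toSubgraph, Walk.support_cons, List.mem_cons] at hc'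
      exact hc'.resolve_left hne
    set e := s(c, w)
    have heC : e ∈ hG.cycle.edgeSet := by
      rw [← hqC, Walk.mem_edges_toSubgraph]; simp [e]
    have hT : (G.deleteEdges {e}).IsAcyclic :=
      hG.isAcyclic_of_le (deleteEdges_le _) heC (by simp [edgeSet_deleteEdges])
    have hFT : hG.forest ≤ G.deleteEdges {e} :=
      deleteEdges_anti (by simpa using heC)
    obtain ⟨s, hs, -⟩ := h.exists_path_of_dist
    have hd : ∀ e' ∈ (t.dropUntil c' hc't).edges, e' ∈ (G.deleteEdges {e}).edgeSet := by
      intro e' he'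
      have h1 := t.edges_dropUntil_subset_edges hc't he'
      rw [edgeSet_deleteEdges]
      exact ⟨t.edges_subset_edgeSet h1, fun h2 => hq.2 (by rwa [← Set.mem_singleton_iff.1 h2])⟩
    have heq : s.mapLe hFT = (t.dropUntil c' hc't).transfer _ hd :=
      congrArg Subtype.val ((hT.subsingleton_path c' c).elim ⟨_, hs.mapLe hFT⟩
        ⟨_, (hq.1.dropUntil hc't).transfer hd⟩)
    have hedges : s.edges = (t.dropUntil c' hc't).edges := by
      have := congrArg Walk.edges heq
      simpa using this
    have hsnil : ¬ s.Nil := fun h => hne h.eq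
    have hse : s(c', s.snd) ∈ s.edges := s.mk_start_snd_mem_edges hsnil
    have h1 := s.edges_subset_edgeSet hse
    rw [edgeSet_deleteEdges] at h1
    refine h1.2 ?_
    rw [← hqC, Walk.mem_edges_toSubgraph, Walk.edges_cons]
    rw [hedges] at hse
    exact List.mem_cons_of_mem _ (t.edges_dropUntil_subset_edges hc't hse)

/-- The vertices of a unicyclic graph are arranged in levels `0, …, k(G) - 1`, with the cycle on
level `0`: a vertex has at most two neighbours on level `0` if it lies there itself, and otherwise
exactly one neighbour on the preceding level; all other neighbours are on the next level. -/
theorem exists_level [Fintype V] (hG : G.IsUnicyclic) : ∃ d : V → ℕ,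
    (∃ v, d v = 0) ∧ (∀ v, d v < hG.height) ∧
    (∀ v, d v = 0 → ∃ s : Finset V, s.card = 2 ∧ (∀ u ∈ s, G.Adj v u ∧ d u = 0) ∧
      ∀ u, G.Adj v u → u ∉ s → d u = 1) ∧
    (∀ v, d v ≠ 0 → ∃ p, G.Adj v p ∧ d p + 1 = d v ∧
      ∀ u, G.Adj v u → u ≠ p → d u = d v + 1) := by
  classical
  choose r hrC hr using hG.exists_root
  have hrroot : ∀ c ∈ hG.cycle.verts, r c = c := fun c hc =>
    hG.eq_of_reachable_forest hc (hrC c) (hr c)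
  have hradj : ∀ u v, hG.forest.Adj u v → r u = r v := fun u v huv =>
    hG.eq_of_reachable_forest (hrC v) (hrC u)
      ((hr u).trans (huv.reachable.trans (hr v).symm))
  have hzero : ∀ v, hG.forest.dist (r v) v = 0 ↔ v ∈ hG.cycle.verts := fun v => by
    rw [(hr v).dist_eq_zero_iff]
    exact ⟨fun h => h ▸ hrC v, hrroot v⟩
  refine ⟨fun v => hG.forest.dist (r v) v, ?_, fun v => ?_, fun v hv => ?_, fun v hv => ?_⟩
  · obtain ⟨c, hc⟩ := hG.exists_mem_cycle_verts
    exact ⟨c, (hzero c).2 hc⟩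
  · refine Nat.lt_succ_of_le ((hG.isAcyclic_forest.dist_le_rootedHeight (hr v)).trans ?_)
    exact Finset.le_sup (f := fun v => hG.forest.rootedHeight v) (by simpa using hrC v)
  · have hvC := (hzero v).1 hv
    refine ⟨Finset.univ.filter (hG.cycle.Adj v), ?_, fun u hu => ?_, fun u hu hus => ?_⟩
    · obtain ⟨a, p, hp, hpC⟩ := hG.isCycleSubgraph_cycle
      have := hp.ncard_neighborSet_toSubgraph_eq_two (v := v)
        (by rwa [← Walk.mem_verts_toSubgraph, hpC])
      rw [hpC] at this
      rw [← this, ← Set.ncard_coe_finset]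
      congr 1
      ext; simp
    · have hu : hG.cycle.Adj v u := by simpa using hu
      exact ⟨hu.adj_sub, (hzero u).2 hu.snd_mem⟩
    · have huF : hG.forest.Adj v u := by
        rw [deleteEdges_adj]; exact ⟨hu, by simpa using hus⟩
      change hG.forest.dist (r u) u = 1
      rw [← hradj _ _ huF, hrroot v hvC, dist_eq_one_iff_adj]
      exact huF
  · have hvC : v ∉ hG.cycle.verts := fun h => hv ((hzero v).2 h)
    have hF : ∀ u, G.Adj v u → hG.forest.Adj v u := fun u hu => by
      rw [deleteEdges_adj]; exact ⟨hu, fun h => hvC (hG.cycle.edge_vert h)⟩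
    obtain ⟨p, hp, hpd⟩ := (hr v).exists_adj_dist_add_one (fun h => hvC (h ▸ hrC v))
    refine ⟨p, (deleteEdges_le _) hp, ?_, fun u hu hup => ?_⟩
    · change hG.forest.dist (r p) p + 1 = _
      rw [← hradj _ _ hp, hpd]
    · change hG.forest.dist (r u) u = hG.forest.dist (r v) v + 1
      rw [← hradj _ _ (hF u hu)]
      have h1 := (hF u hu).diff_dist_adj (u := r v)
      have h2 : ¬ hG.forest.dist (r v) u ≤ hG.forest.dist (r v) v := fun h =>
        hup (hG.isAcyclic_forest.eq_of_adj_of_dist_le (hr v) (hF u hu) hp h (by omega))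
      omega

end IsUnicyclic

end SimpleGraph

/-! ### Numerical estimate -/

/-- The inequality at the cycle vertices: `√(Δ - 1) (2 - √(Δ - 1)) < 2 cos (π / (2 k + 1)) - 1`. -/
theorem two_mul_sqrt_sub_lt_two_mul_cos {Δ k : ℕ} (hΔ : 3 ≤ Δ) (hk : 2 ≤ k)
    (h : 4 ≤ Δ ∨ (Δ = 3 ∧ 4 ≤ k)) :
    2 * √((Δ : ℝ) - 1) - ((Δ : ℝ) - 1) < 2 * Real.cos (Real.pi / (2 * (k : ℝ) + 1)) - 1 := by
  have hs0 : 0 ≤ √((Δ : ℝ) - 1) := Real.sqrt_nonneg _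
  have hΔ' : (3 : ℝ) ≤ Δ := by exact_mod_cast hΔ
  have hs2 : √((Δ : ℝ) - 1) ^ 2 = (Δ : ℝ) - 1 := Real.sq_sqrt (by linarith)
  set s := √((Δ : ℝ) - 1)
  have hcos : ∀ b : ℝ, Real.pi / (2 * (k : ℝ) + 1) ≤ b →
      1 - b ^ 2 / 2 ≤ Real.cos (Real.pi / (2 * (k : ℝ) + 1)) := by
    intro b hb
    have h0 : 0 ≤ Real.pi / (2 * (k : ℝ) + 1) := by positivity
    refine le_trans ?_ Real.one_sub_sq_div_two_le_cos
    gcongr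
  have hpi := Real.pi_lt_d2
  rcases h with h | ⟨rfl, h⟩
  · have hk' : (2 : ℝ) ≤ k := by exact_mod_cast hk
    have h4 : (4 : ℝ) ≤ Δ := by exact_mod_cast h
    -- π/5 < 0.63, and 2s - s² = 1 - (s - 1)² decreases for s ≥ 1.
    have := hcos 0.63 (by rw [div_le_iff₀ (by positivity)]; linarith)
    have hs : 1.73 ≤ s := by
      apply Real.le_sqrt_of_sq_le; norm_num; linarith
    nlinarith
  · have hk' : (4 : ℝ) ≤ k := by exact_mod_cast h
    -- π/9 < 0.35; for Δ = 3 the inequality already fails at k = 3.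
    have := hcos 0.35 (by rw [div_le_iff₀ (by positivity)]; linarith)
    have hs : s ≤ 1.415 := by
      apply Real.sqrt_le_iff.2; norm_num
    norm_num at this ⊢
    linarith

/-! ### Level weights and the test vector -/

namespace SimpleGraph

variable {V : Type*}

/-- A vertex of degree at least 3 is off the cycle or has a neighbour off it. -/
theorem IsUnicyclic.two_le_height [Fintype V] {G : SimpleGraph V} [DecidableRel G.Adj]
    (hG : G.IsUnicyclic) (hΔ : 3 ≤ G.maxDegree) : 2 ≤ hG.height := by
  classical
  obtain ⟨d, -, hdk, hd0, -⟩ := hG.exists_level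
  have := hG.1.nonempty
  obtain ⟨v, hv⟩ := G.exists_maximal_degree_vertex
  by_cases h : d v = 0
  · obtain ⟨s, hs, -, hsn⟩ := hd0 v h
    obtain ⟨u, hu, hus⟩ := Finset.exists_mem_notMem_of_card_lt_card (s := s)
      (t := G.neighborFinset v) (by rw [card_neighborFinset_eq_degree]; omega)
    have := hsn u (by simpa using hu) hus
    have := hdk u
    omega
  · have := hdk v
    omega

theorem alphaMatrix_apply [Fintype V] [DecidableEq V] (G : SimpleGraph V) [DecidableRel G.Adj]
    (α : ℝ) (i j : V) : G.alphaMatrix α i j =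
      (if i = j then α * G.degree i else 0) + if G.Adj i j then 1 - α else 0 := by
  simp [alphaMatrix, degMatrix, Matrix.diagonal_apply]

theorem sum_alphaMatrix_mul [Fintype V] [DecidableEq V] (G : SimpleGraph V) [DecidableRel G.Adj]
    (α : ℝ) (x : V → ℝ) (i : V) : ∑ j, G.alphaMatrix α i j * x j =
      α * G.degree i * x i + (1 - α) * ∑ j ∈ G.neighborFinset i, x j := by
  simp [alphaMatrix_apply, add_mul, Finset.sum_add_distrib, Finset.mul_sum,
    neighborFinset_eq_filter, Finset.sum_filter]

/-- The weights `sin ((k - j) θ) / s ^ j` of the levels, where `θ = π / (2 k + 1)`. -/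
noncomputable def levelWeight (s : ℝ) (k j : ℕ) : ℝ :=
  Real.sin (((k : ℝ) - j) * (Real.pi / (2 * (k : ℝ) + 1))) / s ^ j

theorem levelWeight_pos {s : ℝ} (hs : 0 < s) {k j : ℕ} (hj : j < k) : 0 < levelWeight s k j := by
  have hj' : (0 : ℝ) < (k : ℝ) - j := sub_pos.2 (by exact_mod_cast hj)
  refine div_pos (Real.sin_pos_of_pos_of_lt_pi (by positivity) ?_) (by positivity)
  rw [mul_div_assoc', div_lt_iff₀ (by positivity), mul_comm]
  have : (0 : ℝ) ≤ j := by positivity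
  exact mul_lt_mul_of_pos_left (by linarith) Real.pi_pos

theorem levelWeight_nonneg {s : ℝ} (hs : 0 < s) {k j : ℕ} (hj : j ≤ k) :
    0 ≤ levelWeight s k j := by
  rcases hj.lt_or_eq with h | rfl
  · exact (levelWeight_pos hs h).le
  · simp [levelWeight]

theorem levelWeight_recurrence {s : ℝ} (hs : 0 < s) (k j : ℕ) :
    levelWeight s k j + s ^ 2 * levelWeight s k (j + 2) =
      2 * s * Real.cos (Real.pi / (2 * (k : ℝ) + 1)) * levelWeight s k (j + 1) := by
  unfold levelWeight
  push_cast
  set θ := Real.pi / (2 * (k : ℝ) + 1)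
  have h1 : ((k : ℝ) - j) * θ = ((k : ℝ) - (j + 1)) * θ + θ := by ring
  have h2 : ((k : ℝ) - (j + 2)) * θ = ((k : ℝ) - (j + 1)) * θ - θ := by ring
  rw [h1, h2, Real.sin_add, Real.sin_sub]
  field_simp
  ring

/-- This is the recurrence at j = -1, with w_{-1} = s w_0 because kθ and (k + 1)θ add up to π. -/
theorem levelWeight_one {s : ℝ} (hs : 0 < s) (k : ℕ) :
    s * levelWeight s k 1 =
      (2 * Real.cos (Real.pi / (2 * (k : ℝ) + 1)) - 1) * levelWeight s k 0 := by
  unfold levelWeight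
  set θ := Real.pi / (2 * (k : ℝ) + 1) with hθ
  have h1 : ((k : ℝ) + 1) * θ = Real.pi - k * θ := by
    rw [hθ]; field_simp; ring
  have h2 := Real.sin_pi_sub (k * θ)
  rw [← h1, add_mul, one_mul, Real.sin_add] at h2
  have h3 : ((k : ℝ) - (1 : ℕ)) * θ = k * θ - θ := by push_cast; ring
  rw [h3, Real.sin_sub]
  simp only [Nat.cast_zero, sub_zero, pow_zero, pow_one, div_one]
  field_simp
  linarith

/-- The test vector on a unicyclic graph for the adjacency matrix. -/
theorem IsUnicyclic.exists_weight [Fintype V] {G : SimpleGraph V} [DecidableRel G.Adj]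
    (hG : G.IsUnicyclic) (hΔ : 3 ≤ G.maxDegree)
    (h : 4 ≤ G.maxDegree ∨ (G.maxDegree = 3 ∧ 4 ≤ hG.height)) :
    ∃ x : V → ℝ, (∀ v, 0 < x v) ∧
      (∀ v, ∑ u ∈ G.neighborFinset v, x u ≤ 2 * √((G.maxDegree : ℝ) - 1) *
        Real.cos (Real.pi / (2 * (hG.height : ℝ) + 1)) * x v) ∧
      ∃ v, ∑ u ∈ G.neighborFinset v, x u < 2 * √((G.maxDegree : ℝ) - 1) *
        Real.cos (Real.pi / (2 * (hG.height : ℝ) + 1)) * x v := by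
  classical
  have hk := hG.two_le_height hΔ
  have hcos := two_mul_sqrt_sub_lt_two_mul_cos hΔ hk h
  obtain ⟨d, ⟨v₀, hv₀⟩, hdk, hd0, hd1⟩ := hG.exists_level
  have hΔ' : (3 : ℝ) ≤ G.maxDegree := by exact_mod_cast hΔ
  have hs : 0 < √((G.maxDegree : ℝ) - 1) := Real.sqrt_pos.2 (by linarith)
  have hs2 : √((G.maxDegree : ℝ) - 1) ^ 2 = (G.maxDegree : ℝ) - 1 :=
    Real.sq_sqrt (by linarith)
  have hdeg : ∀ v, (G.degree v : ℝ) ≤ G.maxDegree := fun v => by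
    exact_mod_cast G.degree_le_maxDegree v
  generalize √((G.maxDegree : ℝ) - 1) = s at *
  generalize hG.height = k at *
  have hzero : ∀ v, d v = 0 → ∑ u ∈ G.neighborFinset v, levelWeight s k (d u) <
      2 * s * Real.cos (Real.pi / (2 * (k : ℝ) + 1)) * levelWeight s k (d v) := by
    intro v hv
    obtain ⟨t, ht, htn, hto⟩ := hd0 v hv
    have hsub : t ⊆ G.neighborFinset v := fun u hu => by simpa using (htn u hu).1
    have hsum : ∑ u ∈ G.neighborFinset v, levelWeight s k (d u) =
        ((G.degree v : ℝ) - 2) * levelWeight s k 1 + 2 * levelWeight s k 0 := by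
      rw [← Finset.sum_sdiff hsub,
        Finset.sum_eq_card_nsmul (s := t) (b := levelWeight s k 0) fun u hu => by
          rw [(htn u hu).2],
        Finset.sum_eq_card_nsmul (s := G.neighborFinset v \ t) (b := levelWeight s k 1)
          fun u hu => by
            rw [Finset.mem_sdiff, mem_neighborFinset] at hu; rw [hto u hu.1 hu.2]]
      rw [ht, nsmul_eq_mul, nsmul_eq_mul, Finset.cast_card_sdiff hsub, ht,
        card_neighborFinset_eq_degree]
      norm_num
    have hy := levelWeight_one hs k
    have hy0 := levelWeight_pos hs (k := k) (j := 0) (by omega)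
    have hy1 := levelWeight_nonneg hs (k := k) (j := 1) (by omega)
    rw [hsum, hv]
    have h1 : ((G.degree v : ℝ) - 2) * levelWeight s k 1 ≤ (s ^ 2 - 1) * levelWeight s k 1 :=
      mul_le_mul_of_nonneg_right (by linarith [hdeg v]) hy1
    refine (add_le_add_left h1 _).trans_lt ?_
    rw [← hs2] at hcos
    -- Multiplying by s lets `hy` eliminate w_1; what remains is `hcos` times s w_0.
    refine lt_of_mul_lt_mul_left ?_ hs.le
    nlinarith [mul_pos (sub_pos.2 hcos) hy0]
  refine ⟨fun v => levelWeight s k (d v), fun v => levelWeight_pos hs (hdk v), fun v => ?_,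
    v₀, hzero v₀ hv₀⟩
  by_cases hv : d v = 0
  · exact (hzero v hv).le
  obtain ⟨p, hp, hpd, hpo⟩ := hd1 v hv
  have hpN : p ∈ G.neighborFinset v := by simpa using hp
  have hsum : ∑ u ∈ G.neighborFinset v, levelWeight s k (d u) =
      levelWeight s k (d p) + ((G.degree v : ℝ) - 1) * levelWeight s k (d v + 1) := by
    rw [← Finset.add_sum_erase _ _ hpN,
      Finset.sum_eq_card_nsmul (b := levelWeight s k (d v + 1)) fun u hu => by
        rw [Finset.mem_erase, mem_neighborFinset] at hu; rw [hpo u hu.2 hu.1]]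
    rw [nsmul_eq_mul, Finset.cast_card_erase_of_mem hpN, card_neighborFinset_eq_degree]
  have hrec := levelWeight_recurrence hs k (d p)
  -- The next level may be k itself, where the weight is 0.
  have hnn := levelWeight_nonneg hs (hdk v)
  beta_reduce
  rw [← hpd] at hnn hsum ⊢
  rw [hsum, ← hrec]
  gcongr
  linarith [hdeg v]

end SimpleGraph

/-- The matrix is real and symmetric, so that its spectrum over `ℝ` is its whole spectrum. -/
theorem mainTheorem3 {V : Type*} [Fintype V] [DecidableEq V] (G : SimpleGraph V)
    [DecidableRel G.Adj] (hG : G.IsUnicyclic) (hΔ : 3 ≤ G.maxDegree)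
    (h : 4 ≤ G.maxDegree ∨ (G.maxDegree = 3 ∧ 4 ≤ hG.height))
    (α : ℝ) (hα0 : 0 ≤ α) (hα1 : α < 1) :
    spectralRadius ℝ (G.alphaMatrix α) <
      ENNReal.ofReal (α * (G.maxDegree : ℝ) +
        2 * (1 - α) * Real.sqrt ((G.maxDegree : ℝ) - 1) *
          Real.cos (Real.pi / (2 * (hG.height : ℝ) + 1))) := by
  obtain ⟨x, hx, hle, v₀, hlt⟩ := hG.exists_weight hΔ h
  have hα : 0 < 1 - α := sub_pos.2 hα1
  have hdeg : ∀ v, α * G.degree v * x v ≤ α * G.maxDegree * x v := fun v => by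
    have : (G.degree v : ℝ) ≤ G.maxDegree := by exact_mod_cast G.degree_le_maxDegree v
    have := (hx v).le
    gcongr
  refine Matrix.spectralRadius_lt_of_mulVec_le hG.1 (fun i j => ?_) (fun i j hij => ?_) hx
    (fun i => ?_) (i₀ := v₀) ?_
  · rw [SimpleGraph.alphaMatrix_apply]
    split_ifs <;> positivity
  · rw [SimpleGraph.alphaMatrix_apply, if_neg hij.ne, if_pos hij]
    linarith
  · rw [SimpleGraph.sum_alphaMatrix_mul]
    linarith [hdeg i, mul_le_mul_of_nonneg_left (hle i) hα.le]
  · rw [SimpleGraph.sum_alphaMatrix_mul]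
    linarith [hdeg v₀, mul_lt_mul_of_pos_left hlt hα]
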